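/- Let $-\infty<a<b<\infty$. Let $W^{1,2}((a,b))$ be the set of functions that are absolutely continuous on $[a,b]$ and whose derivative lies in $L^2((a,b))$, and let $W^{-1,2}((a,b))$ be the set of distributions on $(a,b)$ of the form $\phi\mapsto-\int_a^b V\phi'$ with $V\in L^2((a,b))$; such a $V$ is called an antiderivative of the distribution. A distribution is called real if its values on real-valued test functions are real. For $v\in W^{-1,2}((a,b))$ with antiderivative $V\in L^2((a,b))$ and $u\in W^{1,2}((a,b))$, define the distributions $u''$ and $vu$ by $$u''(\phi)=-\int_a^b u'\phi',\qquad (vu)(\phi)=-\int_a^b V\,(u\phi)'$$ (the latter does not depend on the choice of $V$). A real solution of $-u''+vu=0$ is a real-valued $u\in W^{1,2}((a,b))$ satisfying this equation in the sense of distributions on $(a,b)$. **Theorem.** Let $v$ and $\tilde v$ be real distributions in $W^{-1,2}((a,b))$ such that $\tilde v-v$ is a non-negative measure, that is, there is a non-negative Borel measure $\mu$ on $(a,b)$, finite on compact subsets of $(a,b)$, with $(\tilde v-v)(\phi)=\int_{(a,b)}\phi\,d\mu$ for all test functions $\phi$. Suppose that $-u''+\tilde v u=0$ has a real solution $\tilde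 u$ which is not identically zero on $[a,b]$ and satisfies $\tilde u(a)=\tilde u(b)=0$. Then every real solution $u$ of $-u''+vu=0$ has a zero in $(a,b)$ unless it is a constant multiple of $\tilde u$ on $[a,b]$. -/

import Mathlib

open Set MeasureTheory TopologicalSpace
open scoped Distributions

noncomputable section

namespace SturmDistribution

/-- The open interval `(a, b)` as an open subset of the real line. A (complex) distribution on
`(a, b)` is an element of `𝓓'(interval a b, ℂ)`. -/
def interval (a b : ℝ) : Opens ℝ := ⟨Ioo a b, isOpen_Ioo⟩

variable {a b : ℝ}

/-- A distribution is real if its values on real-valued test functions are real.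
(The elements of `𝓓(interval a b, ℝ)` are exactly the real-valued test functions.) -/
def IsReal (v : 𝓓'(interval a b, ℂ)) : Prop :=
  ∀ φ : 𝓓(interval a b, ℝ), (v φ).im = 0

/-- `V ∈ L²((a, b))` is an antiderivative of the distribution `v`: `v(φ) = -∫_a^b V φ'`. -/
def IsL2Antiderivative (v : 𝓓'(interval a b, ℂ)) (V : ℝ → ℂ) : Prop :=
  MemLp V 2 (volume.restrict (Ioo a b)) ∧
    ∀ φ : 𝓓(interval a b, ℝ), v φ = -∫ x in a..b, V x * ((deriv φ x : ℝ) : ℂ)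

/-- The class `W^{-1,2}((a, b))` of the distributions `φ ↦ -∫_a^b V φ'` with
`V ∈ L²((a, b))`. -/
def MemWNegOneTwo (v : 𝓓'(interval a b, ℂ)) : Prop :=
  ∃ V : ℝ → ℂ, IsL2Antiderivative v V

/-- The distribution `v` on `(a, b)` is a non-negative measure: it is integration against a
non-negative Borel measure on `(a, b)` that is finite on compact subsets of `(a, b)`. -/
def IsNonnegMeasure (v : 𝓓'(interval a b, ℂ)) : Prop :=
  ∃ μ : Measure ℝ, (∀ K : Set ℝ, IsCompact K → K ⊆ Ioo a b → μ K < ⊤) ∧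
    ∀ φ : 𝓓(interval a b, ℝ), v φ = ((∫ x in Ioo a b, φ x ∂μ : ℝ) : ℂ)

/-- The (real-valued) functions in the Sobolev space `W^{1,2}((a, b))`: `u` is absolutely
continuous on `[a, b]` and `u' ∈ L²((a, b))`. -/
def MemWOneTwo (a b : ℝ) (u : ℝ → ℝ) : Prop :=
  AbsolutelyContinuousOnInterval u a b ∧ MemLp (deriv u) 2 (volume.restrict (Ioo a b))

/-- The value `u''(φ) = -∫_a^b u' φ'` of the second distributional derivative of
`u ∈ W^{1,2}((a, b))`. -/
def secondDeriv (u : ℝ → ℝ) (φ : 𝓓(interval a b, ℝ)) : ℂ :=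
  -∫ x in a..b, ((deriv u x : ℝ) : ℂ) * ((deriv φ x : ℝ) : ℂ)

/-- The value `(vu)(φ) = -∫_a^b V (uφ)'` of the product of `u ∈ W^{1,2}((a, b))` and the
distribution `v` with antiderivative `V ∈ L²((a, b))`. -/
def product (V : ℝ → ℂ) (u : ℝ → ℝ) (φ : 𝓓(interval a b, ℝ)) : ℂ :=
  -∫ x in a..b, V x * ((deriv (fun t => u t * φ t) x : ℝ) : ℂ)

/-- `u ∈ W^{1,2}((a, b))` is a real solution of `-u'' + v u = 0` in the sense of distributions,
for `v ∈ W^{-1,2}((a, b))`. Two antiderivatives of `v` differ by a constant and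
`∫_a^b (uφ)' = 0`, so the choice of `V` is immaterial. -/
def IsSolution (v : 𝓓'(interval a b, ℂ)) (u : ℝ → ℝ) : Prop :=
  MemWOneTwo a b u ∧ ∃ V : ℝ → ℂ, IsL2Antiderivative v V ∧
    ∀ φ : 𝓓(interval a b, ℝ), -secondDeriv u φ + product V u φ = 0

end SturmDistribution

end

namespace SturmDistribution

open Filter Topology ContDiff Convolution

variable {a b c d : ℝ}

/-! The proof is a Picone (Jacobi) identity in terms of quasi-derivatives. If `u` has no zero in
`(a, b)`, take `u > 0` and write `f` for the solution vanishing at both ends. Let `W`, `V` be real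
antiderivatives of the two potentials and `M = V - W`. The functions `q = u' - W u` and `p = f' - V
f` are absolutely continuous (`exists_quasiDeriv`), and `r = q / u` satisfies the Riccati equation
`r' = -(r + W)²`. Consequently `(p f - r f²)' = (f' - (r + W) f)² - M (f²)'`. Since `M' ≥ 0`,
integration by parts gives `∫ M (f²)' ≤ [M f²]` (`exists_monotoneOn_integral_mul_deriv_le`), so the
integral of the square is at most the boundary term `[p f - r f² + M f²]`.

At the endpoints `r` and `M` may be unbounded, but in the harmful direction they are at most of
order one over the distance to the endpoint (`riccati_bounds`, `monotone_bounds`), whereas `f²` is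
little-o of that distance (`tendsto_sq_div_left`, `tendsto_sq_div_right`). The boundary terms are
therefore at most zero in the limit, the square vanishes almost everywhere, and `f' = (r + W) f =
(u' / u) f`. So the Wronskian vanishes and `f` is a multiple of `u`. -/

/-! ### Functions with non-negative distributional derivative -/

/-- With `ψ` the normalised bump, test the hypothesis on `φ t = ∫ s in (x - t)..(y - t), ψ s`: it is
non-negative, and pairing `M` with `φ'` gives minus the increment of the mollification from `x` to
`y`. The margins `hx`, `hy` keep the support of `φ` inside `(a, b)`. -/
theorem convolution_sub_convolution_nonneg {M : ℝ → ℝ} (hM : IntegrableOn M (Ioo a b))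
    (h : ∀ φ : 𝓓(interval a b, ℝ), (∀ x, 0 ≤ φ x) → ∫ x in Ioo a b, M x * deriv φ x ≤ 0)
    (η : ContDiffBump (0 : ℝ)) {x y : ℝ} (hxy : x ≤ y) (hx : a < x - η.rOut)
    (hy : y + η.rOut < b) :
    (η.normed volume ⋆[ContinuousLinearMap.lsmul ℝ ℝ] (Ioo a b).indicator M) x ≤
      (η.normed volume ⋆[ContinuousLinearMap.lsmul ℝ ℝ] (Ioo a b).indicator M) y := by
  set ψ : ℝ → ℝ := η.normed volume with hψ
  have hψc : Continuous ψ := η.continuous_normed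
  have hψs : ContDiff ℝ ∞ ψ := η.contDiff_normed
  have hψ0 : ∀ t, 0 ≤ ψ t := η.nonneg_normed
  have hψz : ∀ t, η.rOut ≤ |t| → ψ t = 0 := by
    intro t ht
    by_contra hne
    have : t ∈ Function.support ψ := hne
    rw [hψ, η.support_normed_eq] at this
    simp at this
    linarith
  let N : ℝ → ℝ := fun s => ∫ t in (0 : ℝ)..s, ψ t
  have hN : ∀ s, HasDerivAt N (ψ s) s := fun s =>
    intervalIntegral.integral_hasDerivAt_right (hψc.intervalIntegrable _ _)
      (hψc.stronglyMeasurableAtFilter _ _) hψc.continuousAt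
  have hNs : ContDiff ℝ ∞ N := by
    rw [contDiff_infty_iff_deriv]
    refine ⟨fun s => (hN s).differentiableAt, ?_⟩
    rwa [show deriv N = ψ from funext fun s => (hN s).deriv]
  let φ : ℝ → ℝ := fun t => N (y - t) - N (x - t)
  have hφi : ∀ t, φ t = ∫ s in (x - t)..(y - t), ψ s := fun t =>
    intervalIntegral.integral_interval_sub_left (hψc.intervalIntegrable _ _)
      (hψc.intervalIntegrable _ _)
  have hφs : ContDiff ℝ ∞ φ := by
    have h1 : ∀ z : ℝ, ContDiff ℝ ∞ (fun t : ℝ => N (z - t)) := fun z =>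
      hNs.comp (contDiff_const.sub contDiff_id)
    exact (h1 y).sub (h1 x)
  have hφ0 : ∀ t, 0 ≤ φ t := fun t => by
    rw [hφi]
    exact intervalIntegral.integral_nonneg (by linarith) fun s _ => hψ0 s
  have hsupp : tsupport φ ⊆ Icc (x - η.rOut) (y + η.rOut) := by
    refine closure_minimal ?_ isClosed_Icc
    intro t ht
    by_contra hnot
    apply ht
    rw [hφi]
    refine intervalIntegral.integral_zero_ae (Eventually.of_forall fun s hs => hψz s ?_)
    rw [uIoc_of_le (by linarith)] at hs
    rw [mem_Icc, not_and_or, not_le, not_le] at hnot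
    rcases hnot with h1 | h1
    · exact le_trans (by linarith [hs.1]) (le_abs_self s)
    · exact le_trans (by linarith [hs.2]) (neg_le_abs s)
  have hcs : HasCompactSupport φ :=
    isCompact_Icc.of_isClosed_subset (isClosed_tsupport φ) hsupp
  have hderiv : ∀ t, deriv φ t = -(ψ (y - t) - ψ (x - t)) := by
    intro t
    have h1 : ∀ z : ℝ, HasDerivAt (fun t : ℝ => N (z - t)) (-ψ (z - t)) t := fun z => by
      simpa using (hN (z - t)).comp_const_sub z t
    refine ((h1 y).sub (h1 x)).deriv.trans ?_
    ring
  let Φ : 𝓓(interval a b, ℝ) := ⟨φ, hφs, hcs, hsupp.trans (Icc_subset_Ioo hx hy)⟩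
  have key := h Φ hφ0
  have hΦ : ∀ t, deriv Φ t = -(ψ (y - t) - ψ (x - t)) := hderiv
  simp only [hΦ] at key
  have hint : ∀ z, IntegrableOn (fun t => M t * ψ (z - t)) (Ioo a b) := by
    intro z
    obtain ⟨C, hC⟩ := η.hasCompactSupport_normed.exists_bound_of_continuous hψc
    refine Integrable.mul_bdd (c := C) hM ?_ (Eventually.of_forall fun t => hC _)
    exact (hψc.comp (continuous_const.sub continuous_id)).aestronglyMeasurable
  have hconv : ∀ z, (ψ ⋆[ContinuousLinearMap.lsmul ℝ ℝ] (Ioo a b).indicator M) z =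
      ∫ t in Ioo a b, M t * ψ (z - t) := by
    intro z
    rw [convolution_eq_swap, ← integral_indicator measurableSet_Ioo]
    congr 1
    ext t
    by_cases ht : t ∈ Ioo a b <;> simp [ht, mul_comm]
  rw [hconv, hconv, ← sub_nonneg, ← integral_sub (hint y) (hint x)]
  have : (fun t => M t * -(ψ (y - t) - ψ (x - t))) =
      fun t => -(M t * ψ (y - t) - M t * ψ (x - t)) := by ext t; ring
  rw [this, integral_neg] at key
  linarith

/-- A function whose distributional derivative is non-negative is approximated almost everywhere
by smooth functions that are increasing on compact subintervals. -/
theorem exists_monotone_approximation {M : ℝ → ℝ} (hM : IntegrableOn M (Ioo a b))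
    (h : ∀ φ : 𝓓(interval a b, ℝ), (∀ x, 0 ≤ φ x) → ∫ x in Ioo a b, M x * deriv φ x ≤ 0) :
    ∃ F : ℕ → ℝ → ℝ, (∀ n, ContDiff ℝ 1 (F n)) ∧
      (∀ c d, a < c → d < b → ∀ᶠ n in atTop, MonotoneOn (F n) (Icc c d)) ∧
      ∀ᵐ x, x ∈ Ioo a b → Tendsto (fun n => F n x) atTop (𝓝 (M x)) := by
  -- The ratio of outer to inner radius stays equal to 2, as almost everywhere convergence of
  -- mollifications requires a bounded ratio.
  let η : ℕ → ContDiffBump (0 : ℝ) := fun n =>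
    ⟨1 / ((n : ℝ) + 1), 2 * (1 / ((n : ℝ) + 1)), by positivity, by
      have : 0 < 1 / ((n : ℝ) + 1) := by positivity
      linarith⟩
  have hη : Tendsto (fun n => (η n).rOut) atTop (𝓝 0) := by
    have h0 := (tendsto_one_div_add_atTop_nhds_zero_nat (𝕜 := ℝ)).const_mul 2
    rwa [mul_zero] at h0
  have hMi : Integrable ((Ioo a b).indicator M) := by
    rwa [integrable_indicator_iff measurableSet_Ioo]
  refine ⟨fun n => (η n).normed volume ⋆[ContinuousLinearMap.lsmul ℝ ℝ] (Ioo a b).indicator M,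
    fun n => ?_, fun c d hc hd => ?_, ?_⟩
  · exact (η n).hasCompactSupport_normed.contDiff_convolution_left (n := 1) _
      (η n).contDiff_normed hMi.locallyIntegrable
  · have h1 : ∀ᶠ n in atTop, (η n).rOut < min (c - a) (b - d) :=
      hη.eventually_lt_const (by simp [hc, hd])
    filter_upwards [h1] with n hn x hx y hy hxy
    rw [lt_min_iff] at hn
    exact convolution_sub_convolution_nonneg hM h (η n) hxy (by linarith [hx.1])
      (by linarith [hy.2])
  · have := ContDiffBump.ae_convolution_tendsto_right_of_locallyIntegrable (μ := volume)
      (φ := η) (K := 2) hη (Eventually.of_forall fun n => le_rfl) hMi.locallyIntegrable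
    filter_upwards [this] with x hx hxm
    rwa [indicator_of_mem hxm] at hx

/-- Integration by parts for a function `M` with non-negative distributional derivative. -/
theorem exists_monotoneOn_integral_mul_deriv_le {M : ℝ → ℝ} (hM : IntegrableOn M (Ioo a b))
    (h : ∀ φ : 𝓓(interval a b, ℝ), (∀ x, 0 ≤ φ x) → ∫ x in Ioo a b, M x * deriv φ x ≤ 0) :
    ∃ G : Set ℝ, G ⊆ Ioo a b ∧ (∀ᵐ x, x ∈ Ioo a b → x ∈ G) ∧ MonotoneOn M G ∧
      ∀ c ∈ G, ∀ d ∈ G, c ≤ d → ∀ g : ℝ → ℝ, AbsolutelyContinuousOnInterval g c d →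
        (∀ x ∈ Icc c d, 0 ≤ g x) → ∫ x in c..d, M x * deriv g x ≤ M d * g d - M c * g c := by
  obtain ⟨F, hF1, hF2, hF3⟩ := exists_monotone_approximation hM h
  -- `G` consists of the points where the approximations converge to the given value of `M`; there,
  -- pointwise values and boundary terms pass to the limit.
  refine ⟨{x | x ∈ Ioo a b ∧ Tendsto (fun n => F n x) atTop (𝓝 (M x))}, fun x hx => hx.1, ?_, ?_,
    ?_⟩
  · filter_upwards [hF3] with x hx hxm using ⟨hxm, hx hxm⟩
  · intro x hx y hy hxy
    refine le_of_tendsto_of_tendsto hx.2 hy.2 ?_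
    filter_upwards [hF2 x y hx.1.1 hy.1.2] with n hn
    exact hn (left_mem_Icc.2 hxy) (right_mem_Icc.2 hxy) hxy
  · rintro c ⟨hc, hcl⟩ d ⟨hd, hdl⟩ hcd g hg hg0
    have hFac : ∀ n, AbsolutelyContinuousOnInterval (F n) c d := fun n =>
      (hF1 n).contDiffOn.absolutelyContinuousOnInterval
    have hmono := hF2 c d hc.1 hd.2
    have hle : ∀ᶠ n in atTop,
        ∫ x in c..d, F n x * deriv g x ≤ F n d * g d - F n c * g c := by
      filter_upwards [hmono] with n hn
      rw [(hFac n).integral_mul_deriv_eq_deriv_mul hg]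
      have : 0 ≤ ∫ x in c..d, deriv (F n) x * g x := by
        rw [intervalIntegral.integral_of_le hcd, integral_Ioc_eq_integral_Ioo]
        refine setIntegral_nonneg measurableSet_Ioo fun x hx => mul_nonneg ?_
          (hg0 x (Ioo_subset_Icc_self hx))
        have hx' : Icc c d ∈ 𝓝 x := Icc_mem_nhds hx.1 hx.2
        have := hn.derivWithin_nonneg (x := x)
        rwa [derivWithin_of_mem_nhds hx'] at this
      linarith
    have hlim : Tendsto (fun n => ∫ x in c..d, F n x * deriv g x) atTop
        (𝓝 (∫ x in c..d, M x * deriv g x)) := by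
      have hgi := hg.intervalIntegrable_deriv
      -- By monotonicity `F n` lies between its values at `c` and `d`, which converge; this supplies
      -- the dominating constant.
      refine intervalIntegral.tendsto_integral_filter_of_dominated_convergence
        (fun x => (|M c| + |M d| + 1) * |deriv g x|) ?_ ?_ (hgi.abs.const_mul _) ?_
      · exact Eventually.of_forall fun n =>
          (hF1 n).continuous.aestronglyMeasurable.mul hgi.aestronglyMeasurable_restrict_uIoc
      · have e1 : ∀ᶠ n in atTop, M c - 1 < F n c := hcl.eventually_const_lt (by linarith)
        have e2 : ∀ᶠ n in atTop, F n d < M d + 1 := hdl.eventually_lt_const (by linarith)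
        filter_upwards [hmono, e1, e2] with n hn h1 h2
        refine Eventually.of_forall fun x hx => ?_
        rw [uIoc_of_le hcd] at hx
        have hx' := Ioc_subset_Icc_self hx
        have h3 := hn (left_mem_Icc.2 hcd) hx' hx'.1
        have h4 := hn hx' (right_mem_Icc.2 hcd) hx'.2
        rw [norm_mul, Real.norm_eq_abs, Real.norm_eq_abs]
        gcongr
        rw [abs_le]
        constructor <;> linarith [neg_abs_le (M c), le_abs_self (M d), abs_nonneg (M c),
          abs_nonneg (M d)]
      · filter_upwards [hF3] with x hx hxm
        rw [uIoc_of_le hcd] at hxm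
        exact (hx ⟨hc.1.trans hxm.1, hxm.2.trans_lt hd.2⟩).mul_const _
    exact le_of_tendsto_of_tendsto hlim
      ((hdl.mul_const _).sub (hcl.mul_const _)) hle

/-! ### Test functions, du Bois-Reymond and quasi-derivatives -/

theorem _root_.TestFunction.absolutelyContinuousOnInterval (φ : 𝓓(interval a b, ℝ)) (c d : ℝ) :
    AbsolutelyContinuousOnInterval φ c d :=
  (φ.contDiff.of_le (by simp)).contDiffOn.absolutelyContinuousOnInterval

theorem _root_.TestFunction.eq_zero_of_notMem (φ : 𝓓(interval a b, ℝ)) {x : ℝ}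
    (hx : x ∉ Ioo a b) : φ x = 0 :=
  image_eq_zero_of_notMem_tsupport fun h => hx (φ.tsupport_subset h)

theorem _root_.TestFunction.continuous_deriv (φ : 𝓓(interval a b, ℝ)) : Continuous (deriv φ) :=
  φ.contDiff.continuous_deriv (by simp)

theorem _root_.TestFunction.integrableOn_mul {f : ℝ → ℝ} (hf : IntegrableOn f (Ioo a b))
    (φ : 𝓓(interval a b, ℝ)) : IntegrableOn (fun x => f x * φ x) (Ioo a b) := by
  obtain ⟨C, hC⟩ := φ.hasCompactSupport.exists_bound_of_continuous φ.continuous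
  exact Integrable.mul_bdd (c := C) hf φ.continuous.aestronglyMeasurable
    (Eventually.of_forall hC)

theorem _root_.TestFunction.integrableOn_mul_deriv {f : ℝ → ℝ} (hf : IntegrableOn f (Ioo a b))
    (φ : 𝓓(interval a b, ℝ)) : IntegrableOn (fun x => f x * deriv φ x) (Ioo a b) := by
  obtain ⟨C, hC⟩ := φ.hasCompactSupport.deriv.exists_bound_of_continuous φ.continuous_deriv
  exact Integrable.mul_bdd (c := C) hf φ.continuous_deriv.aestronglyMeasurable
    (Eventually.of_forall hC)

theorem intervalIntegrable_of_integrableOn_Ioo {f : ℝ → ℝ} (hab : a ≤ b)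
    (hf : IntegrableOn f (Ioo a b)) : IntervalIntegrable f volume a b := by
  rwa [intervalIntegrable_iff_integrableOn_Ioo_of_le hab]

/-- A primitive of an integrable function is differentiable almost everywhere. -/
theorem ae_deriv_primitive {h : ℝ → ℝ} (hab : a ≤ b) (hh : IntegrableOn h (Ioo a b)) :
    ∀ᵐ x, x ∈ Ioo a b → HasDerivAt (fun x => ∫ t in a..x, h t) (h x) x := by
  have := (intervalIntegrable_of_integrableOn_Ioo hab hh).ae_hasDerivAt_integral
  filter_upwards [this] with x hx hxm
  rw [uIcc_of_le hab] at hx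
  exact hx (Ioo_subset_Icc_self hxm) a (left_mem_Icc.2 hab)

/-- The lemma of du Bois-Reymond. -/
theorem ae_eq_const_sub_integral {f h : ℝ → ℝ} (hab : a < b) (hf : IntegrableOn f (Ioo a b))
    (hh : IntegrableOn h (Ioo a b))
    (H : ∀ φ : 𝓓(interval a b, ℝ),
      ∫ x in Ioo a b, f x * deriv φ x = ∫ x in Ioo a b, h x * φ x) :
    ∃ C : ℝ, ∀ᵐ x, x ∈ Ioo a b → f x = C - ∫ t in a..x, h t := by
  have hhi := intervalIntegrable_of_integrableOn_Ioo hab.le hh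
  set P : ℝ → ℝ := fun x => ∫ t in a..x, h t with hP
  have hPac : AbsolutelyContinuousOnInterval P a b :=
    hhi.absolutelyContinuousOnInterval_intervalIntegral left_mem_uIcc
  have hPi : IntegrableOn P (Ioo a b) := by
    have := hPac.continuousOn
    rw [uIcc_of_le hab.le] at this
    exact (this.integrableOn_Icc).mono_set Ioo_subset_Icc_self
  have hPφ : ∀ φ : 𝓓(interval a b, ℝ),
      ∫ x in Ioo a b, P x * deriv φ x = -∫ x in Ioo a b, h x * φ x := by
    intro φ
    have := hPac.integral_mul_deriv_eq_deriv_mul (φ.absolutelyContinuousOnInterval a b)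
    rw [φ.eq_zero_of_notMem (x := a) (by simp), φ.eq_zero_of_notMem (x := b) (by simp),
      intervalIntegral.integral_of_le hab.le, intervalIntegral.integral_of_le hab.le,
      integral_Ioc_eq_integral_Ioo, integral_Ioc_eq_integral_Ioo] at this
    rw [this]
    simp only [mul_zero, sub_zero, zero_sub, neg_inj]
    refine setIntegral_congr_ae measurableSet_Ioo ?_
    filter_upwards [ae_deriv_primitive hab.le hh] with x hx hxm
    rw [(hx hxm).deriv]
  have hsum : ∀ φ : 𝓓(interval a b, ℝ), ∫ x in Ioo a b, (f x + P x) * deriv φ x = 0 := by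
    intro φ
    simp only [add_mul]
    rw [integral_add (φ.integrableOn_mul_deriv hf) (φ.integrableOn_mul_deriv hPi), H, hPφ]
    ring
  -- `f + P` has zero distributional derivative, so both it and its negative are increasing on sets
  -- of full measure.
  obtain ⟨G₁, hG₁, hG₁', hm₁, -⟩ := exists_monotoneOn_integral_mul_deriv_le (hf.add hPi)
    (fun φ _ => (hsum φ).le)
  obtain ⟨G₂, hG₂, hG₂', hm₂, -⟩ := exists_monotoneOn_integral_mul_deriv_le (hf.add hPi).neg
    (fun φ _ => by
      have : ∀ x, (-(f + P)) x * deriv φ x = -((f x + P x) * deriv φ x) := fun x => by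
        simp only [Pi.neg_apply, Pi.add_apply]; ring
      simp only [this, integral_neg, hsum φ]
      simp)
  have hconst : ∀ x ∈ G₁ ∩ G₂, ∀ y ∈ G₁ ∩ G₂, x ≤ y → f x + P x = f y + P y := by
    intro x hx y hy hxy
    have h1 := hm₁ hx.1 hy.1 hxy
    have h2 := hm₂ hx.2 hy.2 hxy
    simp only [Pi.neg_apply, Pi.add_apply] at h1 h2
    linarith
  rcases (G₁ ∩ G₂).eq_empty_or_nonempty with he | ⟨y, hy⟩
  · refine ⟨0, ?_⟩
    filter_upwards [hG₁', hG₂'] with x h1 h2 hx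
    exact absurd (show x ∈ G₁ ∩ G₂ from ⟨h1 hx, h2 hx⟩) (by simp [he])
  · refine ⟨f y + P y, ?_⟩
    filter_upwards [hG₁', hG₂'] with x h1 h2 hx
    have hxG : x ∈ G₁ ∩ G₂ := ⟨h1 hx, h2 hx⟩
    rcases le_total x y with hxy | hxy
    · linarith [hconst x hxG y hy hxy]
    · linarith [hconst y hy x hxG hxy]

/-- The quasi-derivative `q = u' - W u` of a solution of `-u'' + W' u = 0` is absolutely
continuous, with derivative `-W u'`. -/
theorem exists_quasiDeriv {u W : ℝ → ℝ} (hab : a < b) (hu : MemWOneTwo a b u)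
    (hW : MemLp W 2 (volume.restrict (Ioo a b)))
    (H : ∀ φ : 𝓓(interval a b, ℝ), ∫ x in Ioo a b, deriv u x * deriv φ x =
      ∫ x in Ioo a b, W x * deriv (fun t => u t * φ t) x) :
    ∃ q : ℝ → ℝ, AbsolutelyContinuousOnInterval q a b ∧
      (∀ᵐ x, x ∈ Ioo a b → HasDerivAt u (q x + W x * u x) x) ∧
      ∀ᵐ x, x ∈ Ioo a b → HasDerivAt q (-(W x * deriv u x)) x := by
  obtain ⟨hac, hu2⟩ := hu
  have hWu' : IntegrableOn (fun x => W x * deriv u x) (Ioo a b) := hW.integrable_mul hu2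
  have hui : IntegrableOn (deriv u) (Ioo a b) := hu2.integrable (by norm_num)
  have hWi : IntegrableOn W (Ioo a b) := hW.integrable (by norm_num)
  have hWui : IntegrableOn (fun x => W x * u x) (Ioo a b) := by
    have := (intervalIntegrable_of_integrableOn_Ioo hab.le hWi).mul_continuousOn hac.continuousOn
    rwa [intervalIntegrable_iff_integrableOn_Ioo_of_le hab.le] at this
  have hdiff : ∀ᵐ x, x ∈ Ioo a b → DifferentiableAt ℝ u x := by
    filter_upwards [hac.ae_differentiableAt] with x hx hxm
    exact hx (by rw [uIcc_of_le hab.le]; exact Ioo_subset_Icc_self hxm)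
  -- After expanding `(u φ)'`, the equation says that `u' - W u` has distributional derivative `-W
  -- u'`.
  obtain ⟨C, hC⟩ := ae_eq_const_sub_integral (f := fun x => deriv u x - W x * u x) hab
    (hui.sub hWui) hWu' (fun φ => by
      have h1 : ∫ x in Ioo a b, W x * deriv (fun t => u t * φ t) x =
          ∫ x in Ioo a b, (W x * deriv u x * φ x + W x * u x * deriv φ x) := by
        refine setIntegral_congr_ae measurableSet_Ioo ?_
        filter_upwards [hdiff] with x hx hxm
        have hφ : DifferentiableAt ℝ φ x := φ.contDiff.differentiable (by simp) x
        have hd : deriv (fun t => u t * φ t) x = deriv u x * φ x + u x * deriv φ x :=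
          ((hx hxm).hasDerivAt.mul hφ.hasDerivAt).deriv
        rw [hd]
        ring
      rw [integral_add (φ.integrableOn_mul hWu') (φ.integrableOn_mul_deriv hWui)] at h1
      simp only [sub_mul]
      rw [integral_sub (φ.integrableOn_mul_deriv hui) (φ.integrableOn_mul_deriv hWui), H, h1]
      ring)
  have hpac : AbsolutelyContinuousOnInterval (fun x => ∫ t in a..x, W t * deriv u t) a b :=
    (intervalIntegrable_of_integrableOn_Ioo hab.le
      hWu').absolutelyContinuousOnInterval_intervalIntegral left_mem_uIcc
  refine ⟨fun x => C - ∫ t in a..x, W t * deriv u t, ?_, ?_, ?_⟩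
  · have hCac : AbsolutelyContinuousOnInterval (fun _ : ℝ => C) a b :=
      contDiff_const.contDiffOn.absolutelyContinuousOnInterval
    exact hCac.sub hpac
  · filter_upwards [hC, hdiff] with x hx hxd hxm
    have := (hxd hxm).hasDerivAt
    rwa [show deriv u x = (C - ∫ t in a..x, W t * deriv u t) + W x * u x by
      rw [← hx hxm]; ring] at this
  · filter_upwards [ae_deriv_primitive hab.le hWu'] with x hx hxm
    simpa using (hx hxm).const_sub C

/-! ### Absolutely continuous functions and decay at the endpoints -/

/-- By compactness `1 / f` is bounded by some `C`, and inversion is then Lipschitz with constant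
`C²` on the values of `f`. -/
theorem _root_.AbsolutelyContinuousOnInterval.inv₀ {f : ℝ → ℝ}
    (hf : AbsolutelyContinuousOnInterval f c d) (h0 : ∀ x ∈ uIcc c d, f x ≠ 0) :
    AbsolutelyContinuousOnInterval (fun x => (f x)⁻¹) c d := by
  obtain ⟨C, hC⟩ := isCompact_uIcc.exists_bound_of_continuousOn (hf.continuousOn.inv₀ h0)
  have hC0 : 0 ≤ C := (norm_nonneg _).trans (hC c left_mem_uIcc)
  unfold AbsolutelyContinuousOnInterval at hf ⊢
  refine squeeze_zero' ?_ ?_ (by simpa using hf.const_mul (C * C))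
  · exact Eventually.of_forall fun _ => Finset.sum_nonneg fun i _ => dist_nonneg
  · rw [eventually_inf_principal]
    refine Eventually.of_forall ?_
    rintro ⟨n, I⟩ hnI
    simp only [Finset.mul_sum]
    refine Finset.sum_le_sum fun i hi => ?_
    have h1 := (hnI.1 i hi).1
    have h2 := (hnI.1 i hi).2
    have hb1 := hC _ h1
    have hb2 := hC _ h2
    rw [dist_inv_inv₀ (h0 _ h1) (h0 _ h2), div_eq_inv_mul, mul_inv]
    rw [Pi.inv_apply, norm_inv] at hb1 hb2
    gcongr

theorem _root_.AbsolutelyContinuousOnInterval.integral_eq_sub {f f' : ℝ → ℝ} (hcd : c ≤ d)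
    (hf : AbsolutelyContinuousOnInterval f c d)
    (h : ∀ᵐ x, x ∈ Ioo c d → HasDerivAt f (f' x) x) :
    IntervalIntegrable f' volume c d ∧ ∫ x in c..d, f' x = f d - f c := by
  have h' : ∀ᵐ x, x ∈ Ioo c d → deriv f x = f' x := by
    filter_upwards [h] with x hx hxm using (hx hxm).deriv
  have hi := hf.intervalIntegrable_deriv
  constructor
  · rw [intervalIntegrable_iff_integrableOn_Ioo_of_le hcd] at hi ⊢
    exact (integrableOn_congr_fun_ae ((ae_restrict_iff' measurableSet_Ioo).2 h')).1 hi
  · rw [← hf.integral_deriv_eq_sub, intervalIntegral.integral_of_le hcd,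
      intervalIntegral.integral_of_le hcd, integral_Ioc_eq_integral_Ioo,
      integral_Ioc_eq_integral_Ioo]
    refine setIntegral_congr_ae measurableSet_Ioo ?_
    filter_upwards [h'] with x hx hxm using (hx hxm).symm

/-- Cauchy–Schwarz for `f'` against 1, obtained by expanding `∫ (f' - m)² ≥ 0` with `m` the mean
slope. -/
theorem sq_sub_le_mul_integral_sq {f : ℝ → ℝ} (hcd : c < d)
    (hf : AbsolutelyContinuousOnInterval f c d)
    (h2 : IntervalIntegrable (fun x => deriv f x ^ 2) volume c d) :
    (f d - f c) ^ 2 ≤ (d - c) * ∫ x in c..d, deriv f x ^ 2 := by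
  set m := (f d - f c) / (d - c) with hm
  have hi := hf.intervalIntegrable_deriv
  have hdc : 0 < d - c := sub_pos.2 hcd
  have h0 : 0 ≤ ∫ x in c..d, (deriv f x - m) ^ 2 :=
    intervalIntegral.integral_nonneg hcd.le fun x _ => sq_nonneg _
  have h1 : ∫ x in c..d, (deriv f x - m) ^ 2 =
      ∫ x in c..d, (deriv f x ^ 2 - 2 * m * deriv f x + m ^ 2) := by
    congr 1; ext x; ring
  rw [h1, intervalIntegral.integral_add (h2.sub (hi.const_mul _)) intervalIntegrable_const,
    intervalIntegral.integral_sub h2 (hi.const_mul _), intervalIntegral.integral_const_mul,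
    hf.integral_deriv_eq_sub, intervalIntegral.integral_const, smul_eq_mul] at h0
  have hmd : f d - f c = m * (d - c) := by rw [hm]; field_simp
  rw [hmd] at h0 ⊢
  nlinarith [mul_le_mul_of_nonneg_left h0 hdc.le]

/-- A function in `W^{1,2}` that vanishes at the left endpoint is `o(√(x - a))` there. -/
theorem tendsto_sq_div_left {f : ℝ → ℝ} (hab : a < b) (hf : MemWOneTwo a b f) (h0 : f a = 0) :
    Tendsto (fun x => f x ^ 2 / (x - a)) (𝓝[>] a) (𝓝 0) := by
  have h2 : IntervalIntegrable (fun x => deriv f x ^ 2) volume a b :=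
    intervalIntegrable_of_integrableOn_Ioo hab.le hf.2.integrable_sq
  have hc : ContinuousOn (fun x => ∫ t in a..x, deriv f t ^ 2) (Icc a b) := by
    have := (h2.absolutelyContinuousOnInterval_intervalIntegral left_mem_uIcc).continuousOn
    rwa [uIcc_of_le hab.le] at this
  have hl := (hc a (left_mem_Icc.2 hab.le)).tendsto
  rw [intervalIntegral.integral_same] at hl
  have hl' := hl.mono_left (nhdsWithin_le_of_mem (Icc_mem_nhdsGT hab))
  have hmem : ∀ᶠ x in 𝓝[>] a, x ∈ Ioo a b := Ioo_mem_nhdsGT hab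
  refine squeeze_zero' ?_ ?_ hl'
  · filter_upwards [hmem] with x hx
    exact div_nonneg (sq_nonneg _) (sub_nonneg.2 hx.1.le)
  · filter_upwards [hmem] with x hx
    have hsub : uIcc a x ⊆ uIcc a b := by
      rw [uIcc_of_le hx.1.le, uIcc_of_le hab.le]; exact Icc_subset_Icc_right hx.2.le
    have := sq_sub_le_mul_integral_sq hx.1 (hf.1.mono hsub) (h2.mono_set hsub)
    rw [h0, sub_zero] at this
    rw [div_le_iff₀ (sub_pos.2 hx.1)]
    linarith

/-- A function in `W^{1,2}` that vanishes at the right endpoint is `o(√(b - x))` there. -/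
theorem tendsto_sq_div_right {f : ℝ → ℝ} (hab : a < b) (hf : MemWOneTwo a b f) (h0 : f b = 0) :
    Tendsto (fun x => f x ^ 2 / (b - x)) (𝓝[<] b) (𝓝 0) := by
  have h2 : IntervalIntegrable (fun x => deriv f x ^ 2) volume a b :=
    intervalIntegrable_of_integrableOn_Ioo hab.le hf.2.integrable_sq
  have hc : ContinuousOn (fun x => ∫ t in b..x, deriv f t ^ 2) (Icc a b) := by
    have := (h2.absolutelyContinuousOnInterval_intervalIntegral right_mem_uIcc).continuousOn
    rwa [uIcc_of_le hab.le] at this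
  have hl := (hc b (right_mem_Icc.2 hab.le)).tendsto.neg
  rw [intervalIntegral.integral_same, neg_zero] at hl
  have hl' := hl.mono_left (nhdsWithin_le_of_mem (Icc_mem_nhdsLT hab))
  have hmem : ∀ᶠ x in 𝓝[<] b, x ∈ Ioo a b := Ioo_mem_nhdsLT hab
  refine squeeze_zero' ?_ ?_ hl'
  · filter_upwards [hmem] with x hx
    exact div_nonneg (sq_nonneg _) (sub_nonneg.2 hx.2.le)
  · filter_upwards [hmem] with x hx
    have hsub : uIcc x b ⊆ uIcc a b := by
      rw [uIcc_of_le hx.2.le, uIcc_of_le hab.le]; exact Icc_subset_Icc_left hx.1.le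
    have := sq_sub_le_mul_integral_sq hx.2 (hf.1.mono hsub) (h2.mono_set hsub)
    rw [h0, zero_sub, neg_sq] at this
    rw [div_le_iff₀ (sub_pos.2 hx.2), ← intervalIntegral.integral_symm]
    linarith

/-! ### One-sided endpoint bounds -/

theorem integral_abs_le_setIntegral {W : ℝ → ℝ} (hW : IntegrableOn W (Ioo a b)) (hcd : c ≤ d)
    (hc : a ≤ c) (hd : d ≤ b) : ∫ x in c..d, |W x| ≤ ∫ x in Ioo a b, |W x| := by
  rw [intervalIntegral.integral_of_le hcd, integral_Ioc_eq_integral_Ioo]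
  exact setIntegral_mono_set hW.abs (Eventually.of_forall fun x => abs_nonneg _)
    (Ioo_subset_Ioo hc hd).eventuallyLE

/-- The reciprocal satisfies `(1 / r)' = (1 + W / r)² ≥ 1 - 2 T |W|`; integrate. A solution of
constant sign thus cannot persist long once `1 / r` is small. -/
theorem riccati_length_le {r W : ℝ → ℝ} {T : ℝ} (hcd : c ≤ d)
    (hr : AbsolutelyContinuousOnInterval r c d)
    (hr' : ∀ᵐ x, x ∈ Ioo c d → HasDerivAt r (-(r x + W x) ^ 2) x)
    (hW : IntervalIntegrable W volume c d) (h0 : ∀ x ∈ Icc c d, r x ≠ 0)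
    (hT : ∀ x ∈ Icc c d, |(r x)⁻¹| ≤ T) :
    d - c ≤ (r d)⁻¹ - (r c)⁻¹ + 2 * T * ∫ x in c..d, |W x| := by
  have hder : ∀ᵐ x, x ∈ Ioo c d →
      HasDerivAt (fun x => (r x)⁻¹) ((r x + W x) ^ 2 / r x ^ 2) x := by
    filter_upwards [hr'] with x hx hxm
    have := (hx hxm).fun_inv (h0 x (Ioo_subset_Icc_self hxm))
    rwa [neg_neg] at this
  obtain ⟨hi, he⟩ := (hr.inv₀ (by rwa [uIcc_of_le hcd])).integral_eq_sub hcd hder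
  have hle : ∫ x in c..d, (1 - 2 * T * |W x|) ≤ ∫ x in c..d, (r x + W x) ^ 2 / r x ^ 2 := by
    refine intervalIntegral.integral_mono_on hcd
      (intervalIntegrable_const.sub (hW.abs.const_mul _)) hi fun x hx => ?_
    have hne := h0 x hx
    have h1 : (r x + W x) ^ 2 / r x ^ 2 = (1 + (r x)⁻¹ * W x) ^ 2 := by field_simp
    have h2 : |(r x)⁻¹ * W x| ≤ T * |W x| := by
      rw [abs_mul]; exact mul_le_mul_of_nonneg_right (hT x hx) (abs_nonneg _)
    rw [h1]
    nlinarith [neg_abs_le ((r x)⁻¹ * W x), sq_nonneg ((r x)⁻¹ * W x)]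
  rw [intervalIntegral.integral_sub intervalIntegrable_const (hW.abs.const_mul _),
    intervalIntegral.integral_const_mul, intervalIntegral.integral_const, smul_eq_mul, he] at hle
  linarith

/-- Solutions of the Riccati equation `r' = -(r + W)²` on `(a, b)` are `O(1 / (x - a))` from above
and `O(1 / (b - x))` from below. -/
theorem riccati_bounds {r W : ℝ → ℝ} (hW : IntegrableOn W (Ioo a b))
    (hr : ∀ c d, a < c → c ≤ d → d < b → AbsolutelyContinuousOnInterval r c d)
    (hr' : ∀ᵐ x, x ∈ Ioo a b → HasDerivAt r (-(r x + W x) ^ 2) x) {x : ℝ} (hx : x ∈ Ioo a b) :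
    r x * (x - a) ≤ 1 + 2 * ∫ t in Ioo a b, |W t| ∧
      -r x * (b - x) ≤ 1 + 2 * ∫ t in Ioo a b, |W t| := by
  set A := ∫ t in Ioo a b, |W t| with hA
  have hA0 : 0 ≤ A := integral_nonneg fun _ => abs_nonneg _
  have hder : ∀ c d, a < c → d < b →
      ∀ᵐ x, x ∈ Ioo c d → HasDerivAt r (-(r x + W x) ^ 2) x := by
    intro c d hc hd
    filter_upwards [hr'] with x hx hxm using hx ⟨hc.trans hxm.1, hxm.2.trans hd⟩
  have hWi : ∀ c d, a < c → c ≤ d → d < b → IntervalIntegrable W volume c d := by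
    intro c d hc hcd hd
    exact intervalIntegrable_of_integrableOn_Ioo hcd (hW.mono_set (Ioo_subset_Ioo hc.le hd.le))
  have hanti : ∀ c d, a < c → c ≤ d → d < b → r d ≤ r c := by
    intro c d hc hcd hd
    have := ((hr c d hc hcd hd).integral_eq_sub hcd (hder c d hc hd)).2
    have h2 : ∫ x in c..d, -(r x + W x) ^ 2 ≤ 0 := by
      rw [intervalIntegral.integral_neg, neg_nonpos]
      exact intervalIntegral.integral_nonneg hcd fun x _ => sq_nonneg _
    linarith
  constructor
  · rcases le_or_gt (r x) 0 with h | h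
    · nlinarith [mul_nonneg (neg_nonneg.2 h) (sub_nonneg.2 hx.1.le)]
    · suffices x - (1 + 2 * A) / r x ≤ a by
        rw [sub_le_comm, le_div_iff₀ h] at this
        linarith
      refine le_of_forall_gt_imp_ge_of_dense fun c hc => ?_
      rcases le_total c x with hcx | hcx
      -- Since `r` decreases, it is at least `r x > 0` to the left of `x`, so `1 / r x` bounds the
      -- reciprocal.
      · have key := riccati_length_le (T := (r x)⁻¹) hcx (hr c x hc hcx hx.2) (hder c x hc hx.2)
          (hWi c x hc hcx hx.2)
          (fun y hy => (h.trans_le (hanti y x (hc.trans_le hy.1) hy.2 hx.2)).ne')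
          (fun y hy => by
            have h3 := hanti y x (hc.trans_le hy.1) hy.2 hx.2
            rw [abs_of_pos (inv_pos.2 (h.trans_le h3))]
            exact inv_anti₀ h h3)
        have h4 : 0 < (r c)⁻¹ := inv_pos.2 (h.trans_le (hanti c x hc hcx hx.2))
        have h5 := integral_abs_le_setIntegral hW hcx hc.le hx.2.le
        have h6 : (r x)⁻¹ * ∫ t in c..x, |W t| ≤ (r x)⁻¹ * A :=
          mul_le_mul_of_nonneg_left h5 (inv_pos.2 h).le
        rw [div_eq_inv_mul]
        linarith
      · have : 0 ≤ (1 + 2 * A) / r x := by positivity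
        linarith
  · rcases le_or_gt 0 (r x) with h | h
    · nlinarith [mul_nonneg h (sub_nonneg.2 hx.2.le)]
    · have h' : 0 < -r x := neg_pos.2 h
      suffices b ≤ x + (1 + 2 * A) / (-r x) by
        rw [← sub_le_iff_le_add', le_div_iff₀ h'] at this
        linarith
      refine le_of_forall_lt_imp_le_of_dense fun d hd => ?_
      rcases le_total x d with hxd | hxd
      · have key := riccati_length_le (T := (-r x)⁻¹) hxd (hr x d hx.1 hxd hd) (hder x d hx.1 hd)
          (hWi x d hx.1 hxd hd)
          (fun y hy => ((hanti x y hx.1 hy.1 (hy.2.trans_lt hd)).trans_lt h).ne)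
          (fun y hy => by
            have h3 := hanti x y hx.1 hy.1 (hy.2.trans_lt hd)
            rw [abs_of_neg (inv_lt_zero.2 (h3.trans_lt h)), ← inv_neg]
            exact inv_anti₀ h' (neg_le_neg h3))
        have h4 : (r d)⁻¹ < 0 := inv_lt_zero.2 ((hanti x d hx.1 hxd hd).trans_lt h)
        have h5 := integral_abs_le_setIntegral hW hxd hx.1.le hd.le
        have h6 : (-r x)⁻¹ * ∫ t in x..d, |W t| ≤ (-r x)⁻¹ * A :=
          mul_le_mul_of_nonneg_left h5 (inv_pos.2 h').le
        rw [div_eq_inv_mul]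
        have h7 : (-r x)⁻¹ = -(r x)⁻¹ := inv_neg
        linarith
      · have : 0 ≤ (1 + 2 * A) / (-r x) := by positivity
        linarith

/-- An integrable function that is increasing on a set of full measure in `(a, b)` is
`O(1 / (x - a))` from below and `O(1 / (b - x))` from above. -/
theorem monotone_bounds {M : ℝ → ℝ} {G : Set ℝ} (hM : IntegrableOn M (Ioo a b))
    (hG : G ⊆ Ioo a b) (hG' : ∀ᵐ x, x ∈ Ioo a b → x ∈ G) (hmono : MonotoneOn M G) {x : ℝ}
    (hx : x ∈ G) :
    -M x * (x - a) ≤ ∫ t in Ioo a b, |M t| ∧ M x * (b - x) ≤ ∫ t in Ioo a b, |M t| := by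
  obtain ⟨hxa, hxb⟩ := hG hx
  have hi : ∀ c d, a ≤ c → c ≤ d → d ≤ b → IntervalIntegrable M volume c d := by
    intro c d hc hcd hd
    exact intervalIntegrable_of_integrableOn_Ioo hcd (hM.mono_set (Ioo_subset_Ioo hc hd))
  constructor
  · refine le_trans ?_ (integral_abs_le_setIntegral hM hxa.le le_rfl hxb.le)
    -- To the left of `x`, almost every value of `M` is at most `M x`, so `-M x ≤ |M|` there;
    -- integrate over `(a, x)`.
    have : ∫ _ in a..x, -M x = -M x * (x - a) := by
      rw [intervalIntegral.integral_const, smul_eq_mul, mul_comm]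
    rw [← this]
    refine intervalIntegral.integral_mono_ae_restrict hxa.le intervalIntegrable_const
      (hi a x le_rfl hxa.le hxb.le).abs ?_
    rw [← restrict_Ioo_eq_restrict_Icc, EventuallyLE, ae_restrict_iff' measurableSet_Ioo]
    filter_upwards [hG'] with y hy hym
    have := hmono (hy ⟨hym.1, hym.2.trans hxb⟩) hx hym.2.le
    linarith [neg_abs_le (M y)]
  · refine le_trans ?_ (integral_abs_le_setIntegral hM hxb.le hxa.le le_rfl)
    have : ∫ _ in x..b, M x = M x * (b - x) := by
      rw [intervalIntegral.integral_const, smul_eq_mul, mul_comm]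
    rw [← this]
    refine intervalIntegral.integral_mono_ae_restrict hxb.le intervalIntegrable_const
      (hi x b hxa.le hxb.le le_rfl).abs ?_
    rw [← restrict_Ioo_eq_restrict_Icc, EventuallyLE, ae_restrict_iff' measurableSet_Ioo]
    filter_upwards [hG'] with y hy hym
    have := hmono hx (hy ⟨hxa.trans hym.1, hym.2⟩) hym.1.le
    linarith [le_abs_self (M y)]

/-! ### Comparison with a positive solution -/

/-- Boundary terms involving `M` are controlled only on a set of full measure. Such a set meets
every one-sided neighbourhood of the endpoint, since these have positive measure. -/
theorem exists_mem_Ioo_of_eventually_nhdsGT {G : Set ℝ} {p : ℝ → Prop} (hab : a < b)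
    (hG : ∀ᵐ x, x ∈ Ioo a b → x ∈ G) (hp : ∀ᶠ x in 𝓝[>] a, p x) :
    ∃ x ∈ Ioo a b, x ∈ G ∧ p x := by
  obtain ⟨e, he, hep⟩ := mem_nhdsGT_iff_exists_Ioo_subset.1 hp
  have hlt : a < min e b := lt_min he hab
  have hne : (ae (volume.restrict (Ioo a (min e b)))).NeBot := by
    rw [ae_neBot, Ne, Measure.restrict_eq_zero, Real.volume_Ioo, ENNReal.ofReal_eq_zero]
    linarith
  have hev : ∀ᵐ x ∂volume.restrict (Ioo a (min e b)), x ∈ Ioo a b ∧ x ∈ G ∧ p x := by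
    rw [ae_restrict_iff' measurableSet_Ioo]
    filter_upwards [hG] with x hx hxm
    have h1 : x ∈ Ioo a b := ⟨hxm.1, hxm.2.trans_le (min_le_right _ _)⟩
    exact ⟨h1, hx h1, hep ⟨hxm.1, hxm.2.trans_le (min_le_left _ _)⟩⟩
  exact hev.exists

theorem exists_mem_Ioo_of_eventually_nhdsLT {G : Set ℝ} {p : ℝ → Prop} (hab : a < b)
    (hG : ∀ᵐ x, x ∈ Ioo a b → x ∈ G) (hp : ∀ᶠ x in 𝓝[<] b, p x) :
    ∃ x ∈ Ioo a b, x ∈ G ∧ p x := by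
  obtain ⟨e, he, hep⟩ := mem_nhdsLT_iff_exists_Ioo_subset.1 hp
  have hlt : max e a < b := max_lt he hab
  have hne : (ae (volume.restrict (Ioo (max e a) b))).NeBot := by
    rw [ae_neBot, Ne, Measure.restrict_eq_zero, Real.volume_Ioo, ENNReal.ofReal_eq_zero]
    linarith
  have hev : ∀ᵐ x ∂volume.restrict (Ioo (max e a) b), x ∈ Ioo a b ∧ x ∈ G ∧ p x := by
    rw [ae_restrict_iff' measurableSet_Ioo]
    filter_upwards [hG] with x hx hxm
    have h1 : x ∈ Ioo a b := ⟨(le_max_right _ _).trans_lt hxm.1, hxm.2⟩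
    exact ⟨h1, hx h1, hep ⟨(le_max_left _ _).trans_lt hxm.1, hxm.2⟩⟩
  exact hev.exists

/-- A quotient of absolutely continuous functions with vanishing Wronskian is constant. -/
theorem exists_eq_const_mul_of_wronskian {u f : ℝ → ℝ} (hab : a < b)
    (hu : AbsolutelyContinuousOnInterval u a b) (hf : AbsolutelyContinuousOnInterval f a b)
    (hpos : ∀ x ∈ Ioo a b, 0 < u x)
    (hW : ∀ᵐ x, x ∈ Ioo a b → deriv f x * u x - f x * deriv u x = 0) :
    ∃ k : ℝ, ∀ x ∈ Ioo a b, f x = k * u x := by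
  have key : ∀ c d, a < c → c ≤ d → d < b → f c * (u c)⁻¹ = f d * (u d)⁻¹ := by
    intro c d hc hcd hd
    have hsub : uIcc c d ⊆ uIcc a b := by
      rw [uIcc_of_le hcd, uIcc_of_le hab.le]; exact Icc_subset_Icc hc.le hd.le
    have hsub' : uIcc c d ⊆ Ioo a b := by
      rw [uIcc_of_le hcd]; exact Icc_subset_Ioo hc hd
    have hu' := hu.mono hsub
    have hf' := hf.mono hsub
    have hq : AbsolutelyContinuousOnInterval (fun x => f x * (u x)⁻¹) c d :=
      hf'.fun_mul (hu'.inv₀ fun x hx => (hpos x (hsub' hx)).ne')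
    obtain ⟨C, hC⟩ := hq.const_of_ae_hasDerivAt_zero (by
      filter_upwards [hW, hu'.ae_differentiableAt, hf'.ae_differentiableAt] with x h1 h2 h3 hx
      have hne := (hpos x (hsub' hx)).ne'
      refine ((h3 hx).hasDerivAt.fun_mul ((h2 hx).hasDerivAt.fun_inv hne)).congr_deriv ?_
      have h4 := h1 (hsub' hx)
      field_simp
      linarith)
    rw [hC c left_mem_uIcc, hC d right_mem_uIcc]
  have hm : (a + b) / 2 ∈ Ioo a b := ⟨by linarith, by linarith⟩
  refine ⟨f ((a + b) / 2) * (u ((a + b) / 2))⁻¹, fun x hx => ?_⟩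
  have hne := (hpos x hx).ne'
  have : f x * (u x)⁻¹ = f ((a + b) / 2) * (u ((a + b) / 2))⁻¹ := by
    rcases le_total x ((a + b) / 2) with h | h
    · exact key _ _ hx.1 h hm.2
    · exact (key _ _ hm.1 h hx.2).symm
  rw [← this, mul_assoc, inv_mul_cancel₀ hne, mul_one]

/-- Sturm comparison for a positive solution `u` of `-u'' + W' u = 0` and a solution `f` of
`-f'' + V' f = 0` vanishing at both endpoints, where `V' - W'` is a non-negative measure. -/
theorem exists_eq_const_mul_of_pos {u f W V : ℝ → ℝ} (hab : a < b)
    (hu : MemWOneTwo a b u) (hf : MemWOneTwo a b f)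
    (hW : MemLp W 2 (volume.restrict (Ioo a b))) (hV : MemLp V 2 (volume.restrict (Ioo a b)))
    (Hu : ∀ φ : 𝓓(interval a b, ℝ), ∫ x in Ioo a b, deriv u x * deriv φ x =
      ∫ x in Ioo a b, W x * deriv (fun t => u t * φ t) x)
    (Hf : ∀ φ : 𝓓(interval a b, ℝ), ∫ x in Ioo a b, deriv f x * deriv φ x =
      ∫ x in Ioo a b, V x * deriv (fun t => f t * φ t) x)
    (Hμ : ∀ φ : 𝓓(interval a b, ℝ), (∀ x, 0 ≤ φ x) →
      ∫ x in Ioo a b, (V x - W x) * deriv φ x ≤ 0)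
    (hpos : ∀ x ∈ Ioo a b, 0 < u x) (hfa : f a = 0) (hfb : f b = 0) :
    ∃ k : ℝ, ∀ x ∈ Ioo a b, f x = k * u x := by
  obtain ⟨q, hq, huq, hqd⟩ := exists_quasiDeriv hab hu hW Hu
  obtain ⟨p, hp, hfp, hpd⟩ := exists_quasiDeriv hab hf hV Hf
  have hM2 : MemLp (fun x => V x - W x) 2 (volume.restrict (Ioo a b)) := hV.sub hW
  have hWi : IntegrableOn W (Ioo a b) := hW.integrable (by norm_num)
  have hMi : IntegrableOn (fun x => V x - W x) (Ioo a b) := hM2.integrable (by norm_num)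
  obtain ⟨G, hGsub, hGae, hGmono, hGint⟩ := exists_monotoneOn_integral_mul_deriv_le hMi Hμ
  have hsub : ∀ {c d}, a < c → c ≤ d → d < b → uIcc c d ⊆ uIcc a b := by
    intro c d hc hcd hd
    rw [uIcc_of_le hcd, uIcc_of_le hab.le]; exact Icc_subset_Icc hc.le hd.le
  set r : ℝ → ℝ := fun x => q x * (u x)⁻¹ with hr
  have hrac : ∀ c d, a < c → c ≤ d → d < b → AbsolutelyContinuousOnInterval r c d := by
    intro c d hc hcd hd
    refine (hq.mono (hsub hc hcd hd)).fun_mul ((hu.1.mono (hsub hc hcd hd)).inv₀ fun x hx => ?_)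
    rw [uIcc_of_le hcd] at hx
    exact (hpos x (Icc_subset_Ioo hc hd hx)).ne'
  have hrd : ∀ᵐ x, x ∈ Ioo a b → HasDerivAt r (-(r x + W x) ^ 2) x := by
    filter_upwards [huq, hqd] with x h1 h2 hx
    have hne := (hpos x hx).ne'
    have h3 := (h2 hx).fun_mul ((h1 hx).fun_inv hne)
    rw [(h1 hx).deriv] at h3
    refine h3.congr_deriv ?_
    simp only [hr]
    field_simp
    ring
  have hrb := fun x hx => riccati_bounds (x := x) hWi hrac hrd hx
  have hMb := fun x hx => monotone_bounds (x := x) hMi hGsub hGae hGmono hx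
  set A := ∫ t in Ioo a b, |W t|
  set A' := ∫ t in Ioo a b, |V t - W t|
  -- `D` is the square and `B` the boundary expression in the Picone identity, which is `hBd` below.
  set D : ℝ → ℝ := fun x => (deriv f x - f x * (r x + W x)) ^ 2 with hD
  set B : ℝ → ℝ := fun x => p x * f x - r x * (f x * f x) with hB
  have hff : AbsolutelyContinuousOnInterval (fun x => f x * f x) a b := hf.1.fun_mul hf.1
  have hffd : ∀ᵐ x, x ∈ Ioo a b → deriv (fun x => f x * f x) x = 2 * f x * deriv f x := by
    filter_upwards [hfp] with x h1 hx
    have h2 : HasDerivAt f (deriv f x) x := (h1 hx).differentiableAt.hasDerivAt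
    have h3 : deriv (fun x => f x * f x) x = deriv f x * f x + f x * deriv f x := (h2.mul h2).deriv
    rw [h3]; ring
  have hMff : IntegrableOn (fun x => (V x - W x) * deriv (fun x => f x * f x) x) (Ioo a b) := by
    have h1 : IntegrableOn (fun x => (V x - W x) * deriv f x) (Ioo a b) := hM2.integrable_mul hf.2
    have h2 : IntegrableOn (fun x => (V x - W x) * deriv f x * (2 * f x)) (Ioo a b) := by
      have := (intervalIntegrable_of_integrableOn_Ioo hab.le h1).mul_continuousOn
        (hf.1.continuousOn.const_smul (2 : ℝ))
      rw [intervalIntegrable_iff_integrableOn_Ioo_of_le hab.le] at this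
      exact this
    refine (integrableOn_congr_fun_ae ((ae_restrict_iff' measurableSet_Ioo).2 ?_)).1 h2
    filter_upwards [hffd] with x h3 hx
    rw [h3 hx]; ring
  have hBd : ∀ᵐ x, x ∈ Ioo a b →
      HasDerivAt B (D x - (V x - W x) * deriv (fun x => f x * f x) x) x := by
    filter_upwards [hfp, hpd, hrd, hffd] with x h1 h2 h3 h4 hx
    have h5 := ((h2 hx).fun_mul (h1 hx)).fun_sub ((h3 hx).fun_mul ((h1 hx).fun_mul (h1 hx)))
    refine h5.congr_deriv ?_
    rw [h4 hx]
    simp only [hD]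
    rw [(h1 hx).deriv]
    ring
  have hDint : ∀ c d, a < c → c ≤ d → d < b → IntervalIntegrable D volume c d ∧
      ∫ x in c..d, D x =
        B d - B c + ∫ x in c..d, (V x - W x) * deriv (fun x => f x * f x) x := by
    intro c d hc hcd hd
    have hBac : AbsolutelyContinuousOnInterval B c d :=
      ((hp.mono (hsub hc hcd hd)).fun_mul (hf.1.mono (hsub hc hcd hd))).fun_sub
        ((hrac c d hc hcd hd).fun_mul (hff.mono (hsub hc hcd hd)))
    obtain ⟨h1, h2⟩ := hBac.integral_eq_sub hcd (by
      filter_upwards [hBd] with x h1 hx using h1 ⟨hc.trans hx.1, hx.2.trans hd⟩)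
    have h3 : IntervalIntegrable (fun x => (V x - W x) * deriv (fun x => f x * f x) x) volume c d :=
      intervalIntegrable_of_integrableOn_Ioo hcd (hMff.mono_set (Ioo_subset_Ioo hc.le hd.le))
    have h4 := h1.add h3
    have h5 : (fun x => D x - (V x - W x) * deriv (fun x => f x * f x) x +
        (V x - W x) * deriv (fun x => f x * f x) x) = D := by ext x; ring
    have h6 := intervalIntegral.integral_add h1 h3
    refine ⟨by simpa only [sub_add_cancel] using h4, ?_⟩
    rw [← h2, ← h6, h5]
  obtain ⟨K, hK⟩ := hp.exists_bound
  rw [uIcc_of_le hab.le] at hK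
  -- The Riccati bound contributes `1 + 2 * A` and the bound for `V - W` contributes `A'`.
  set L := 1 + 2 * A + A' with hL
  have hfc : ContinuousOn f (Icc a b) := by simpa [uIcc_of_le hab.le] using hf.1.continuousOn
  have hbound : ∀ c ∈ G, ∀ d ∈ G, c ≤ d → ∫ x in c..d, D x ≤
      (K * |f c| + L * (f c ^ 2 / (c - a))) + (K * |f d| + L * (f d ^ 2 / (b - d))) := by
    intro c hc d hd hcd
    have hc' := hGsub hc
    have hd' := hGsub hd
    rw [(hDint c d hc'.1 hcd hd'.2).2]
    have h1 := hGint c hc d hd hcd (fun x => f x * f x) (hff.mono (hsub hc'.1 hcd hd'.2))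
      fun x _ => mul_self_nonneg _
    have hpf : ∀ x ∈ Ioo a b, |p x * f x| ≤ K * |f x| := fun x hx => by
      rw [abs_mul]
      exact mul_le_mul_of_nonneg_right (hK x (Ioo_subset_Icc_self hx)) (abs_nonneg _)
    have h2 : (r c - (V c - W c)) * (f c * f c) ≤ L * (f c ^ 2 / (c - a)) := by
      have h0 : 0 < c - a := sub_pos.2 hc'.1
      have h3 : (r c - (V c - W c)) ≤ L / (c - a) := by
        rw [le_div_iff₀ h0]
        linarith [(hrb c hc').1, (hMb c hc).1]
      calc _ ≤ L / (c - a) * (f c * f c) := mul_le_mul_of_nonneg_right h3 (mul_self_nonneg _)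
        _ = _ := by ring
    have h3 : (-r d + (V d - W d)) * (f d * f d) ≤ L * (f d ^ 2 / (b - d)) := by
      have h0 : 0 < b - d := sub_pos.2 hd'.2
      have h3 : (-r d + (V d - W d)) ≤ L / (b - d) := by
        rw [le_div_iff₀ h0]
        linarith [(hrb d hd').2, (hMb d hd).2]
      calc _ ≤ L / (b - d) * (f d * f d) := mul_le_mul_of_nonneg_right h3 (mul_self_nonneg _)
        _ = _ := by ring
    have h4 := hpf c hc'
    have h5 := hpf d hd'
    have h6 := neg_abs_le (p c * f c)
    have h7 := le_abs_self (p d * f d)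
    simp only [hB]
    linarith
  have hlimA : Tendsto (fun c => K * |f c| + L * (f c ^ 2 / (c - a))) (𝓝[>] a) (𝓝 0) := by
    have h1 : Tendsto f (𝓝[>] a) (𝓝 0) := by
      have := (hfc a (left_mem_Icc.2 hab.le)).tendsto
      rw [hfa] at this
      exact this.mono_left (nhdsWithin_le_of_mem (Icc_mem_nhdsGT hab))
    simpa using (h1.abs.const_mul K).add ((tendsto_sq_div_left hab hf hfa).const_mul L)
  have hlimB : Tendsto (fun d => K * |f d| + L * (f d ^ 2 / (b - d))) (𝓝[<] b) (𝓝 0) := by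
    have h1 : Tendsto f (𝓝[<] b) (𝓝 0) := by
      have := (hfc b (right_mem_Icc.2 hab.le)).tendsto
      rw [hfb] at this
      exact this.mono_left (nhdsWithin_le_of_mem (Icc_mem_nhdsLT hab))
    simpa using (h1.abs.const_mul K).add ((tendsto_sq_div_right hab hf hfb).const_mul L)
  have hDnn : ∀ x, 0 ≤ D x := fun x => sq_nonneg _
  have hDzero : ∀ c d, a < c → c < d → d < b → ∀ᵐ x, x ∈ Ioo c d → D x = 0 := by
    intro c d hc hcd hd
    have hle : ∫ x in c..d, D x ≤ 0 := by
      refine le_of_forall_pos_le_add fun ε hε => ?_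
      -- Enlarge `[c, d]` to `[c', d']` with endpoints in `G` so close to `a` and `b` that each
      -- boundary term is below `ε / 2`; as `D ≥ 0`, the integral can only grow.
      obtain ⟨c', hc', hc'G, hc'e⟩ := exists_mem_Ioo_of_eventually_nhdsGT hc
        (G := G) (by filter_upwards [hGae] with x hx hxm using hx ⟨hxm.1, hxm.2.trans (hcd.trans hd)⟩)
        (hlimA.eventually_lt_const (half_pos hε))
      obtain ⟨d', hd', hd'G, hd'e⟩ := exists_mem_Ioo_of_eventually_nhdsLT hd
        (G := G) (by filter_upwards [hGae] with x hx hxm using hx ⟨(hc.trans hcd).trans hxm.1, hxm.2⟩)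
        (hlimB.eventually_lt_const (half_pos hε))
      have hcd' : c' ≤ d' := (hc'.2.trans (hcd.trans hd'.1)).le
      have h1 := hbound c' hc'G d' hd'G hcd'
      have h2 : ∫ x in c..d, D x ≤ ∫ x in c'..d', D x :=
        intervalIntegral.integral_mono_interval hc'.2.le hcd.le hd'.1.le
          (Eventually.of_forall hDnn) (hDint c' d' hc'.1 hcd' hd'.2).1
      linarith
    have hge : 0 ≤ ∫ x in c..d, D x :=
      intervalIntegral.integral_nonneg hcd.le fun x _ => hDnn x
    have h0 := le_antisymm hle hge
    rw [intervalIntegral.integral_eq_zero_iff_of_nonneg_ae (Eventually.of_forall hDnn)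
      (hDint c d hc hcd.le hd).1] at h0
    have h1 := (ae_restrict_iff' (measurableSet_Ioc.union measurableSet_Ioc)).1 h0
    filter_upwards [h1] with x hx hxm
    exact hx (Or.inl (Ioo_subset_Ioc_self hxm))
  have hDae : ∀ᵐ x, x ∈ Ioo a b → D x = 0 := by
    -- Countably many compact subintervals exhaust `(a, b)`, so the exceptional null sets can be
    -- united.
    obtain ⟨s, hs1, hs2, hs3⟩ := exists_seq_strictAnti_tendsto' hab
    obtain ⟨t, ht1, ht2, ht3⟩ := exists_seq_strictMono_tendsto' hab
    have h1 : ∀ᵐ x, ∀ n m : ℕ, s n < t m → x ∈ Ioo (s n) (t m) → D x = 0 := by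
      rw [ae_all_iff]; intro n
      rw [ae_all_iff]; intro m
      by_cases h : s n < t m
      · filter_upwards [hDzero _ _ (hs2 n).1 h (ht2 m).2] with x hx _ using hx
      · exact Eventually.of_forall fun x h' => absurd h' h
    filter_upwards [h1] with x hx hxm
    obtain ⟨n, hn⟩ := (hs3.eventually_lt_const hxm.1).exists
    obtain ⟨m, hm⟩ := (ht3.eventually_const_lt hxm.2).exists
    exact hx n m (hn.trans hm) ⟨hn, hm⟩
  refine exists_eq_const_mul_of_wronskian hab hu.1 hf.1 hpos ?_
  filter_upwards [hDae, huq] with x h1 h2 hx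
  have hne := (hpos x hx).ne'
  -- Because `r + W = u' / u`, this is the vanishing of the Wronskian.
  have h3 : deriv f x - f x * (r x + W x) = 0 := by simpa [hD] using h1 hx
  rw [(h2 hx).deriv, sub_eq_zero.1 h3]
  simp only [hr]
  field_simp
  ring

/-! ### Passage to real-valued antiderivatives -/

theorem IsL2Antiderivative.re_memLp {v : 𝓓'(interval a b, ℂ)} {V : ℝ → ℂ}
    (hV : IsL2Antiderivative v V) :
    MemLp (fun x => (V x).re) 2 (volume.restrict (Ioo a b)) := hV.1.re

theorem re_intervalIntegral {F : ℝ → ℂ} (hab : a ≤ b) (hF : IntegrableOn F (Ioo a b)) :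
    (∫ x in a..b, F x).re = ∫ x in Ioo a b, (F x).re := by
  rw [intervalIntegral.integral_of_le hab, integral_Ioc_eq_integral_Ioo]
  exact (integral_re hF).symm

theorem _root_.TestFunction.memLp_deriv (φ : 𝓓(interval a b, ℝ)) :
    MemLp (deriv φ) 2 (volume.restrict (Ioo a b)) :=
  (φ.continuous_deriv.memLp_of_hasCompactSupport φ.hasCompactSupport.deriv).restrict _

theorem IsL2Antiderivative.re_apply {v : 𝓓'(interval a b, ℂ)} {V : ℝ → ℂ} (hab : a ≤ b)
    (hV : IsL2Antiderivative v V) (φ : 𝓓(interval a b, ℝ)) :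
    (v φ).re = -∫ x in Ioo a b, (V x).re * deriv φ x := by
  have hi : IntegrableOn (fun x => V x * ((deriv φ x : ℝ) : ℂ)) (Ioo a b) :=
    hV.1.integrable_mul φ.memLp_deriv.ofReal
  rw [hV.2 φ, Complex.neg_re, re_intervalIntegral hab hi]
  simp

/-- As `u` and `φ` are real, taking real parts of the equation replaces `V` by its real part.
Splitting the integrals needs `(u φ)'` in `L²`, which follows from the product rule and the
boundedness of `u` and `φ`. -/
theorem IsSolution.exists_re {v : 𝓓'(interval a b, ℂ)} {u : ℝ → ℝ} (hab : a < b)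
    (hu : IsSolution v u) :
    ∃ W : ℝ → ℝ, MemLp W 2 (volume.restrict (Ioo a b)) ∧
      (∀ φ : 𝓓(interval a b, ℝ), (v φ).re = -∫ x in Ioo a b, W x * deriv φ x) ∧
      ∀ φ : 𝓓(interval a b, ℝ), ∫ x in Ioo a b, deriv u x * deriv φ x =
        ∫ x in Ioo a b, W x * deriv (fun t => u t * φ t) x := by
  obtain ⟨⟨hac, hu2⟩, V, hV, h⟩ := hu
  refine ⟨fun x => (V x).re, hV.re_memLp, hV.re_apply hab.le, fun φ => ?_⟩
  have hφ2 := φ.memLp_deriv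
  have h1 : IntegrableOn (fun x => ((deriv u x : ℝ) : ℂ) * ((deriv φ x : ℝ) : ℂ)) (Ioo a b) :=
    hu2.ofReal.integrable_mul hφ2.ofReal
  have huφ : MemLp (deriv fun t => u t * φ t) 2 (volume.restrict (Ioo a b)) := by
    obtain ⟨C, hC⟩ := hac.exists_bound
    have huc := hac.continuousOn
    rw [uIcc_of_le hab.le] at huc hC
    have hutop : MemLp u ⊤ (volume.restrict (Ioo a b)) :=
      memLp_top_of_bound ((huc.mono Ioo_subset_Icc_self).aestronglyMeasurable measurableSet_Ioo) C
        ((ae_restrict_iff' measurableSet_Ioo).2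
          (Eventually.of_forall fun x hx => hC x (Ioo_subset_Icc_self hx)))
    have h2 : MemLp (fun x => deriv u x * φ x) 2 (volume.restrict (Ioo a b)) :=
      φ.memLp_top.mul' hu2
    have h3 : MemLp (fun x => u x * deriv φ x) 2 (volume.restrict (Ioo a b)) := hφ2.mul' hutop
    refine (memLp_congr_ae ((ae_restrict_iff' measurableSet_Ioo).2 ?_)).1 (h2.add h3)
    filter_upwards [hac.ae_differentiableAt] with x hx hxm
    have hd := (hx (by rw [uIcc_of_le hab.le]; exact Ioo_subset_Icc_self hxm)).hasDerivAt
    have hφd : DifferentiableAt ℝ φ x := φ.contDiff.differentiable (by simp) x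
    exact (hd.fun_mul hφd.hasDerivAt).deriv.symm
  have h2 : IntegrableOn (fun x => V x * ((deriv (fun t => u t * φ t) x : ℝ) : ℂ)) (Ioo a b) :=
    hV.1.integrable_mul huφ.ofReal
  have key := congrArg Complex.re (h φ)
  simp only [secondDeriv, product, neg_neg, Complex.add_re, Complex.neg_re, Complex.zero_re] at key
  rw [re_intervalIntegral hab.le h1, re_intervalIntegral hab.le h2] at key
  simp only [← Complex.ofReal_mul, Complex.ofReal_re, Complex.re_mul_ofReal] at key
  linarith

theorem IsSolution.neg {v : 𝓓'(interval a b, ℂ)} {u : ℝ → ℝ} (hu : IsSolution v u) :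
    IsSolution v (fun x => -u x) := by
  obtain ⟨⟨hac, hu2⟩, V, hV, h⟩ := hu
  have hd : deriv (fun x => -u x) = fun x => -deriv u x := by ext x; exact deriv.fun_neg
  refine ⟨⟨hac.fun_neg, ?_⟩, V, hV, fun φ => ?_⟩
  · rw [hd]; exact hu2.neg
  · have h1 : secondDeriv (fun x => -u x) φ = -secondDeriv u φ := by
      simp [secondDeriv, hd, intervalIntegral.integral_neg]
    have h2 : product V (fun x => -u x) φ = -product V u φ := by
      simp [product, neg_mul, deriv.fun_neg, intervalIntegral.integral_neg]
    rw [h1, h2, ← neg_add, h φ, neg_zero]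

theorem eqOn_Icc_of_pos {v vt : 𝓓'(interval a b, ℂ)} {u ut : ℝ → ℝ} (hab : a < b)
    (hμ : IsNonnegMeasure (vt - v)) (hut : IsSolution vt ut) (hut_ne : ∃ x ∈ Icc a b, ut x ≠ 0)
    (hut_a : ut a = 0) (hut_b : ut b = 0) (hu : IsSolution v u) (hpos : ∀ x ∈ Ioo a b, 0 < u x) :
    ∃ c : ℝ, ∀ x ∈ Icc a b, u x = c * ut x := by
  obtain ⟨W, hW, hvW, Hu⟩ := hu.exists_re hab
  obtain ⟨V, hV, hvV, Hf⟩ := hut.exists_re hab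
  obtain ⟨μ, -, hμ⟩ := hμ
  obtain ⟨k, hk⟩ := exists_eq_const_mul_of_pos hab hu.1 hut.1 hW hV Hu Hf (fun φ hφ => by
    have h1 := congrArg Complex.re (hμ φ)
    have h2 : (vt - v) φ = vt φ - v φ := rfl
    rw [h2, Complex.sub_re, hvV, hvW, Complex.ofReal_re] at h1
    have h3 : 0 ≤ ∫ x in Ioo a b, φ x ∂μ := integral_nonneg hφ
    simp only [sub_mul]
    rw [integral_sub (φ.integrableOn_mul_deriv (hV.integrable (by norm_num)))
      (φ.integrableOn_mul_deriv (hW.integrable (by norm_num)))]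
    linarith) hpos hut_a hut_b
  have huc : ContinuousOn u (Icc a b) := by simpa [uIcc_of_le hab.le] using hu.1.1.continuousOn
  have hutc : ContinuousOn ut (Icc a b) := by
    simpa [uIcc_of_le hab.le] using hut.1.1.continuousOn
  -- Continuity carries the proportionality to the endpoints. Then `k ≠ 0` because `ut` is not
  -- identically zero, and the relation can be inverted.
  have hk' : EqOn ut (fun x => k * u x) (Icc a b) := by
    have : EqOn ut (fun x => k * u x) (Ioo a b) := hk
    refine this.of_subset_closure hutc (huc.const_smul k) Ioo_subset_Icc_self ?_
    rw [closure_Ioo hab.ne]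
  obtain ⟨x₀, hx₀, hne⟩ := hut_ne
  have hk0 : k ≠ 0 := by
    rintro rfl
    exact hne (by simpa using hk' hx₀)
  refine ⟨k⁻¹, fun x hx => ?_⟩
  have h1 : ut x = k * u x := hk' hx
  rw [h1, ← mul_assoc, inv_mul_cancel₀ hk0, one_mul]

end SturmDistribution

theorem mainTheorem6 (a b : ℝ) (hab : a < b)
    (v vt : 𝓓'(SturmDistribution.interval a b, ℂ))
    (hv : SturmDistribution.MemWNegOneTwo v) (hv_real : SturmDistribution.IsReal v)
    (hvt : SturmDistribution.MemWNegOneTwo vt) (hvt_real : SturmDistribution.IsReal vt)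
    (hμ : SturmDistribution.IsNonnegMeasure (vt - v))
    (ut : ℝ → ℝ) (hut : SturmDistribution.IsSolution vt ut)
    (hut_ne : ∃ x ∈ Icc a b, ut x ≠ 0) (hut_a : ut a = 0) (hut_b : ut b = 0)
    (u : ℝ → ℝ) (hu : SturmDistribution.IsSolution v u) :
    (∃ x ∈ Ioo a b, u x = 0) ∨ ∃ c : ℝ, ∀ x ∈ Icc a b, u x = c * ut x := by
  by_cases hz : ∃ x ∈ Ioo a b, u x = 0
  · exact Or.inl hz
  right
  push Not at hz
  have huc : ContinuousOn u (Ioo a b) := by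
    have := hu.1.1.continuousOn
    rw [uIcc_of_le hab.le] at this
    exact this.mono Ioo_subset_Icc_self
  -- A zero-free continuous function on an interval has constant sign; the negative case reduces to
  -- the positive one by linearity.
  have hsign : (∀ x ∈ Ioo a b, 0 < u x) ∨ ∀ x ∈ Ioo a b, 0 < -u x := by
    by_contra hcon
    push Not at hcon
    obtain ⟨⟨x, hx, hx0⟩, y, hy, hy0⟩ := hcon
    obtain ⟨z, hz', hz0⟩ := isPreconnected_Ioo.intermediate_value hx hy huc
      (show (0 : ℝ) ∈ Icc (u x) (u y) from ⟨hx0, by linarith⟩)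
    exact hz z hz' hz0
  rcases hsign with h | h
  · exact SturmDistribution.eqOn_Icc_of_pos hab hμ hut hut_ne hut_a hut_b hu h
  · obtain ⟨c, hc⟩ :=
      SturmDistribution.eqOn_Icc_of_pos hab hμ hut hut_ne hut_a hut_b hu.neg h
    exact ⟨-c, fun x hx => by linarith [hc x hx]⟩
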